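/- Let $n\ge 1$, and let $\mathcal G$ be an arbitrary set of abstract (unlabeled) simple graphs with $n+1$ vertices. A *conowheel set* of size $n+1$ is a set $P=H\cup\{w\}$ of $n+1$ points in the plane, with $|H|=n$ and $w\notin H$, such that no three points of $P$ lie on a common line and every point of $H$ is a vertex of the convex hull of $P$ (the point $w$ may or may not be one). For $h\in H$ let $l(h)$ and $r(h)$ be the numbers of points of $P$ strictly to the left and strictly to the right, respectively, of the line through $w$ and $h$, directed from $w$ to $h$. The *frequency vector* of $P$ is $F(P)=(F_0,\dots,F_{n-1})$, where $F_k$ is the number of $h\in H$ with $|l(h)-r(h)|=k$. Let $\mathrm{nb}_{\mathcal G}(P)$ be the number of crossing-free geometric graphs on $P$ that are isomorphic to a graph in $\mathcal G$, i.e. of graphs with vertex set $P$, with edges drawn as straight segments, in which no two distinct edges intersect in their relative interiors. Then $\mathrm{nb}_{\mathcal G}(P)$ depends only on $F(P)$: if $P$ and $P'$ are conowheel sets of size $n+1$ with $F(P)=F(P')$, then $\mathrm{nb}_{\mathcal G}(P)=\mathrm{nb}_{\mathcal G}(P')$. More concretely, there are integers $\gamma_n$ and $\lambda_{l,r}=\lambda_{r,l}$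 ($l,r\ge 0$) and rationals $\Lambda_0,\dots,\Lambda_{n-1}$, depending only on $n$ and $\mathcal G$, such that for every conowheel set $P=H\cup\{w\}$ of size $n+1$ $$\mathrm{nb}_{\mathcal G}(P)=\gamma_n-\frac12\sum_{h\in H}\lambda_{l(h),r(h)}=\sum_{k=0}^{n-1}F_k\Lambda_k .$$ -/

import Mathlib

/-- The Euclidean plane. -/
abbrev Plane : Type := EuclideanSpace ℝ (Fin 2)

/-- Twice the signed area of the triangle `a b c`: positive iff `c` lies strictly to the left of the
line through `a` and `b`, directed from `a` to `b`, and negative iff it lies strictly to the right. -/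
def orient (a b c : Plane) : ℝ :=
  (b 0 - a 0) * (c 1 - a 1) - (b 1 - a 1) * (c 0 - a 0)

/-- No three distinct points of `P` lie on a common line. -/
def InGeneralPosition (P : Set Plane) : Prop :=
  ∀ a ∈ P, ∀ b ∈ P, ∀ c ∈ P, a ≠ b → a ≠ c → b ≠ c → ¬ Collinear ℝ ({a, b, c} : Set Plane)

/-- The point set `P = H ∪ {w}`. -/
def pointSet (H : Finset Plane) (w : Plane) : Set Plane := insert w (H : Set Plane)

/-- `P = H ∪ {w}` (with `w ∉ H`) is a conowheel set: it is in general position and every point of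
`H` is a vertex of the convex hull of `P`. The extra point `w` may be extreme (then `P` is in convex
position) or not (then `P` is a wheel set). -/
structure IsConowheelSet (H : Finset Plane) (w : Plane) : Prop where
  notMem : w ∉ H
  generalPosition : InGeneralPosition (pointSet H w)
  extreme : ∀ h ∈ H, h ∈ (convexHull ℝ (pointSet H w)).extremePoints ℝ

/-- The number of points of `P = H ∪ {w}` strictly to the left of the line directed from `w`
to `h`. -/
noncomputable def leftCount (H : Finset Plane) (w h : Plane) : ℕ :=
  {p ∈ pointSet H w | 0 < orient w h p}.ncard

/-- The number of points of `P = H ∪ {w}` strictly to the right of the line directed from `w`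
to `h`. -/
noncomputable def rightCount (H : Finset Plane) (w h : Plane) : ℕ :=
  {p ∈ pointSet H w | orient w h p < 0}.ncard

/-- The frequency vector `(F_0, …, F_{n-1})` of `P = H ∪ {w}`, where `n` is the size of `H`:
`F_k` is the number of `h ∈ H` whose left and right counts differ by exactly `k`. -/
noncomputable def freqVector (n : ℕ) (H : Finset Plane) (w : Plane) : Fin n → ℕ := fun k =>
  {h ∈ (H : Set Plane) | |(leftCount H w h : ℤ) - (rightCount H w h : ℤ)| = (k : ℕ)}.ncard

/-- A geometric graph on `P` (vertex set `P`, edges drawn as straight segments) is crossing-free if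
no two distinct edges intersect in their relative interiors. -/
def IsCrossingFree {P : Set Plane} (G : SimpleGraph P) : Prop :=
  ∀ a b c d : P, G.Adj a b → G.Adj c d → s(a, b) ≠ s(c, d) →
    Disjoint (openSegment ℝ (a : Plane) (b : Plane)) (openSegment ℝ (c : Plane) (d : Plane))

/-- The number of crossing-free geometric graphs on `P` that are isomorphic to a graph in the family
`𝒢` of graphs with `m` vertices. -/
noncomputable def numCrossingFree {m : ℕ} (𝒢 : Set (SimpleGraph (Fin m))) (P : Set Plane) : ℕ :=
  {G : SimpleGraph P | IsCrossingFree G ∧ ∃ A ∈ 𝒢, Nonempty (G ≃g A)}.ncard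

/-! Crossing-freeness splits into a condition that ignores the position of the centre and one that
uses it. `Admissible` involves only triples of rim points, whose orientations form a cyclic order
because every rim point is extreme. Hence the number γ of admissible graphs in the family depends
only on n and 𝒢. Crossing-free means `Admissible` and `Visible` (`isCrossingFree_iff`).

An admissible graph that is not visible has exactly one directed rim edge ab with the centre on its
left and `Behind` satisfied (`exists_behind`, `behind_unique`): ab is the last edge to be crossed on
the way from the centre to its neighbours. `Behind` too ignores where the centre lies, so by
renumbering the rim (`exists_isWheelEquiv`) the number of such graphs is m k, where k counts the rim
points to the right of ab.

It remains to sum m k over all directed pairs ab with the centre on the left. For fixed a, those b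
are linearly ordered around a and k is the rank of b, so the sum over b is ∑_{k < l(a)} m k; for
fixed b, the sum over a is likewise ∑_{k < r(b)} m k. Adding the two evaluations gives the symmetric
λ_{l,r} = ∑_{k < l} m k + ∑_{k < r} m k and the factor 1/2. Since l + r = n - 1, the value |l - r|
determines the unordered pair {l, r}, hence λ. -/

/-- The relation `L a b c` (`c` lies to the left of the line from `a` to `b`) behaves as it does for
a planar point set in general position all of whose points except possibly `o` are extreme. -/
structure WheelOrder {W : Type*} (o : W) (L : W → W → W → Prop) : Prop where
  cyc : ∀ {a b c}, L a b c → L b c a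
  asymm : ∀ {a b c}, L a b c → ¬ L b a c
  total : ∀ {a b c}, a ≠ b → a ≠ c → b ≠ c → L a b c ∨ L b a c
  extreme : ∀ {a x y z}, a ≠ o → L a x y → L a y z → ¬ L a z x

/-- The line through `a` and `b` strictly separates `p` from `q`. -/
def Separates {W : Type*} (L : W → W → W → Prop) (a b p q : W) : Prop :=
  (L a b p ∧ L b a q) ∨ (L b a p ∧ L a b q)

/-- The edges of `G` avoiding `o` do not cross each other, and none of them separates two
neighbours of `o`. -/
structure Admissible {W : Type*} (o : W) (L : W → W → W → Prop) (G : SimpleGraph W) : Prop where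
  noncrossing : ∀ a b c d, a ≠ o → b ≠ o → c ≠ o → d ≠ o → G.Adj a b → G.Adj c d →
    ¬ Separates L a b c d
  unsplit : ∀ a b s t, a ≠ o → b ≠ o → G.Adj a b → G.Adj o s → G.Adj o t → ¬ Separates L a b s t

/-- No edge of `G` avoiding `o` separates `o` from one of its neighbours. -/
def Visible {W : Type*} (o : W) (L : W → W → W → Prop) (G : SimpleGraph W) : Prop :=
  ∀ a b s, a ≠ o → b ≠ o → G.Adj a b → G.Adj o s → ¬ Separates L a b o s

/-- The neighbours of `o`, not all among `a` and `b`, are vertices of the cell of `G - o` that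
touches the edge `a b` from the right. -/
structure Behind {W : Type*} (o : W) (L : W → W → W → Prop) (G : SimpleGraph W) (a b : W) :
    Prop where
  left_ne : a ≠ o
  right_ne : b ≠ o
  adj : G.Adj a b
  exists_right : ∃ s, G.Adj o s ∧ L b a s
  right : ∀ s, G.Adj o s → s = a ∨ s = b ∨ L b a s
  same_left : ∀ c d s, c ≠ o → d ≠ o → G.Adj c d → G.Adj o s → ¬ Separates L c d s a
  same_right : ∀ c d s, c ≠ o → d ≠ o → G.Adj c d → G.Adj o s → ¬ Separates L c d s b

/-! ### Chords of a wheel order and the unique edge that hides the neighbours of the centre -/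

namespace WheelOrder

variable {W : Type*} {o : W} {L : W → W → W → Prop}

/-- Reflection exchanges the two ends of a chord, so statements about one end transfer to the other.
-/
theorem mirror (h : WheelOrder o L) : WheelOrder o (fun a b c => L b a c) where
  cyc := fun H => h.cyc (h.cyc H)
  asymm := fun H H' => h.asymm H H'
  total := fun h1 h2 h3 => (h.total h1 h2 h3).symm
  extreme := fun ha h1 h2 h3 => h.extreme ha (h.cyc h1) (h.cyc h3) (h.cyc h2)

theorem cyc' (h : WheelOrder o L) {a b c : W} (H : L a b c) : L c a b := h.cyc (h.cyc H)

theorem ne12 (h : WheelOrder o L) {a b c : W} (H : L a b c) : a ≠ b := by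
  rintro rfl; exact h.asymm H H

theorem ne23 (h : WheelOrder o L) {a b c : W} (H : L a b c) : b ≠ c := h.ne12 (h.cyc H)

theorem ne13 (h : WheelOrder o L) {a b c : W} (H : L a b c) : a ≠ c := (h.ne12 (h.cyc' H)).symm

/-- An extreme point sees all other points within a half-plane, so they are linearly ordered by
angle around it. This is the main use of extremality. -/
theorem trans (h : WheelOrder o L) {a x y z : W} (ha : a ≠ o) (h1 : L a x y) (h2 : L a y z) :
    L a x z := by
  have hxz : x ≠ z := by
    rintro rfl
    exact h.asymm h1 (h.cyc' h2)
  rcases h.total (h.ne12 h1) (h.ne13 h2) hxz with H | H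
  · exact H
  · exact absurd (h.cyc H) (h.extreme ha h1 h2)

/-- If the chord `c d` separates `a` from `s`, the chord `a b` does not cross `c d`, and `s` lies to
the right of `a b`, then everything to the right of `c d` lies to the right of `a b`. -/
theorem right_of_right (h : WheelOrder o L) {a b c d s : W} (ha : a ≠ o) (hb : b ≠ o) (hc : c ≠ o)
    (hs : L d c s) (hda : L c d a) (hbs : L b a s) (hcd : b = c ∨ b = d ∨ L c d b) :
    L b a c ∧ ∀ x, L d c x → L b a x := by
  have hsd : L c s d := h.cyc hs
  have hba : L c b a := by
    rcases hcd with rfl | rfl | hdb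
    · exact absurd hbs (h.extreme hc hsd hda)
    · exact hda
    · by_contra hn
      have hab : L c a b := by
        rcases h.total (h.ne13 hdb) (h.ne13 hda) (h.ne12 hbs) with H | H
        · exact absurd H hn
        · exact h.cyc H
      have hsa : L c s a := h.trans hc hsd hda
      exact h.extreme ha (h.cyc hbs) (h.cyc hab) (h.cyc' hsa)
  refine ⟨h.cyc hba, fun x hx => ?_⟩
  have hxb : L c x b := by
    rcases hcd with rfl | rfl | hdb
    · exact absurd rfl (h.ne12 hba)
    · exact h.cyc hx
    · exact h.trans hc (h.cyc hx) hdb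
  have hxa : L c x a := h.trans hc hxb hba
  rcases h.total (h.ne12 hbs) (h.ne23 hxb).symm (h.ne23 hxa).symm with H | H
  · exact H
  · exact absurd (h.cyc' hxb) (fun H' => h.extreme hb H' (h.cyc H) (h.cyc hba))
end WheelOrder

namespace WheelOrder

variable {W : Type*} {o : W} {L : W → W → W → Prop}

theorem right_of_right' (h : WheelOrder o L) {a b c d s : W} (ha : a ≠ o) (hb : b ≠ o) (hd : d ≠ o)
    (hs : L d c s) (hdb : L c d b) (hbs : L b a s) (hcd : a = c ∨ a = d ∨ L c d a) :
    L b a d ∧ ∀ x, L d c x → L b a x :=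
  h.mirror.right_of_right (a := b) (b := a) (c := d) (d := c) hb ha hd hs hdb hbs (by tauto)

theorem eq_or_of_not_separates (h : WheelOrder o L) {a b p q : W} (hab : a ≠ b)
    (hn : ¬ Separates L a b p q) (hp : L b a p) : q = a ∨ q = b ∨ L b a q := by
  by_contra! hc
  rcases h.total hab hc.1.symm hc.2.1.symm with H | H
  · exact hn (Or.inr ⟨hp, H⟩)
  · exact hc.2.2 H

/-- Of two chords with `o` on the left, not both lie to the right of the other. -/
theorem left_of_both (h : WheelOrder o L) {a b c d : W} (hb : b ≠ o) (hd : d ≠ o)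
    (habo : L a b o) (hcdo : L c d o)
    (h1 : b = c ∨ b = d ∨ L d c b) (h2 : d = a ∨ d = b ∨ L b a d) : b = d := by
  by_contra hbd
  have e1 : L b o d := by
    rcases h2 with rfl | H | H
    · exact h.cyc habo
    · exact absurd H.symm hbd
    · exact h.trans hb (h.cyc habo) H
  have e2 : L d o b := by
    rcases h1 with rfl | H | H
    · exact h.cyc hcdo
    · exact absurd H hbd
    · exact h.trans hd (h.cyc hcdo) H
  exact h.asymm (h.cyc' e1) (h.cyc' e2)

/-- Each edge has a neighbour of the centre strictly on its right, and no edge separates that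
neighbour from the ends of the other edge. So each edge lies weakly to the right of the other, which
with the centre on both left sides forces equality. -/
theorem behind_unique (h : WheelOrder o L) {G : SimpleGraph W} {a b c d : W}
    (habo : L a b o) (hcdo : L c d o) (h1 : Behind o L G a b) (h2 : Behind o L G c d) :
    a = c ∧ b = d := by
  have key : ∀ {a b c d : W}, Behind o L G a b → Behind o L G c d →
      (a = c ∨ a = d ∨ L d c a) ∧ (b = c ∨ b = d ∨ L d c b) := by
    intro a b c d h1 h2
    obtain ⟨t, ht, hdt⟩ := h2.exists_right
    exact ⟨h.eq_or_of_not_separates (h.ne12 hdt).symm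
        (h1.same_left c d t h2.left_ne h2.right_ne h2.adj ht) hdt,
      h.eq_or_of_not_separates (h.ne12 hdt).symm
        (h1.same_right c d t h2.left_ne h2.right_ne h2.adj ht) hdt⟩
  have k1 := key h1 h2
  have k2 := key h2 h1
  exact ⟨h.mirror.left_of_both (a := b) (c := d) h1.left_ne h2.left_ne habo hcdo
      (by tauto) (by tauto),
    h.left_of_both h1.right_ne h2.right_ne habo hcdo k1.2 k2.2⟩

theorem not_behind_of_visible {G : SimpleGraph W} (hv : Visible o L G) {a b : W}
    (habo : L a b o) : ¬ Behind o L G a b := by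
  intro hB
  obtain ⟨s, hs, hbs⟩ := hB.exists_right
  exact hv a b s hB.left_ne hB.right_ne hB.adj hs (Or.inl ⟨habo, hbs⟩)

/-- Among the directed rim edges with the centre on the left and a neighbour of it on the right, one
with fewest points on its right works: an edge cutting a neighbour off from an end of it would have
an even smaller right side. -/
theorem exists_behind [Finite W] (h : WheelOrder o L) {G : SimpleGraph W} (hG : Admissible o L G)
    (hv : ¬ Visible o L G) : ∃ a b, L a b o ∧ Behind o L G a b := by
  obtain ⟨p, ⟨hp1, hp2, hpG, hpo, s, hs, hps⟩, hmin⟩ :=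
    Set.exists_min_image {p : W × W | p.1 ≠ o ∧ p.2 ≠ o ∧ G.Adj p.1 p.2 ∧ L p.1 p.2 o ∧
      ∃ s, G.Adj o s ∧ L p.2 p.1 s} (fun p => {x | L p.2 p.1 x}.ncard) (Set.toFinite _) (by
        unfold Visible at hv
        push Not at hv
        obtain ⟨a, b, s, ha, hb, hab, hs, H | H⟩ := hv
        · exact ⟨(a, b), ha, hb, hab, H.1, s, hs, H.2⟩
        · exact ⟨(b, a), hb, ha, hab.symm, H.1, s, hs, H.2⟩)
  obtain ⟨a, b⟩ := p
  dsimp only at *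
  have hright : ∀ t, G.Adj o t → t = a ∨ t = b ∨ L b a t := fun t ht =>
    h.eq_or_of_not_separates (h.ne12 hpo) (hG.unsplit a b s t hp1 hp2 hpG hs ht) hps
  have hclosed : ∀ c d y x, c ≠ o → d ≠ o → G.Adj c d → (y = a ∨ y = b) → L c d y →
      (x = a ∨ x = b) → x = c ∨ x = d ∨ L c d x := by
    intro c d y x hc hd hcd hy hy' hx
    have := h.eq_or_of_not_separates (a := d) (b := c) (p := y) (q := x) hcd.ne.symm (by
      intro hsep
      rcases hy with rfl | rfl <;> rcases hx with rfl | rfl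
      · exact hsep.elim (fun H => h.asymm H.1 H.2) (fun H => h.asymm H.1 H.2)
      · exact hG.noncrossing _ _ _ _ hd hc hp1 hp2 hcd.symm hpG hsep
      · exact hG.noncrossing _ _ _ _ hd hc hp2 hp1 hcd.symm hpG.symm hsep
      · exact hsep.elim (fun H => h.asymm H.1 H.2) (fun H => h.asymm H.1 H.2)) hy'
    tauto
  -- Such a chord cd contradicts minimality. The centre is to its left, since otherwise it would
  -- also be to the right of ab; the inclusion of right sides is proper because c or d lies right of
  -- ab but not right of cd.
  have hfin : ∀ c d t, c ≠ o → d ≠ o → G.Adj c d → G.Adj o t → L d c t →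
      (∀ x, L d c x → L b a x) → (L b a c ∨ L b a d) → False := by
    intro c d t hc hd hcd ht hdt hsub hstrict
    rcases h.total hcd.ne hc hd with H | H
    · have := hmin (c, d) ⟨hc, hd, hcd, H, t, ht, hdt⟩
      refine absurd this (not_le.2 (Set.ncard_lt_ncard ⟨hsub, fun hss => ?_⟩ (Set.toFinite _)))
      rcases hstrict with H' | H'
      · exact h.ne23 (hss H') rfl
      · exact h.ne13 (hss H') rfl
    · exact h.asymm hpo (hsub o H)
  have hleft : ∀ c d t, c ≠ o → d ≠ o → G.Adj c d → G.Adj o t → ¬ (L d c t ∧ L c d a) := by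
    rintro c d t hc hd hcd ht ⟨hdt, hda⟩
    have hbt : L b a t := by
      rcases hright t ht with rfl | rfl | H
      · exact absurd hda (h.asymm hdt)
      · exact absurd (Or.inr ⟨hdt, hda⟩) (hG.noncrossing c d t a hc hd hp2 hp1 hcd hpG.symm)
      · exact H
    obtain ⟨e1, e2⟩ := h.right_of_right hp1 hp2 hc hdt hda hbt
      (hclosed c d a b hc hd hcd (Or.inl rfl) hda (Or.inr rfl))
    exact hfin c d t hc hd hcd ht hdt e2 (Or.inl e1)
  have hleft' : ∀ c d t, c ≠ o → d ≠ o → G.Adj c d → G.Adj o t → ¬ (L d c t ∧ L c d b) := by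
    rintro c d t hc hd hcd ht ⟨hdt, hdb⟩
    have hbt : L b a t := by
      rcases hright t ht with rfl | rfl | H
      · exact absurd (Or.inr ⟨hdt, hdb⟩) (hG.noncrossing c d t b hc hd hp1 hp2 hcd hpG)
      · exact absurd hdb (h.asymm hdt)
      · exact H
    obtain ⟨e1, e2⟩ := h.right_of_right' hp1 hp2 hd hdt hdb hbt
      (hclosed c d b a hc hd hcd (Or.inr rfl) hdb (Or.inl rfl))
    exact hfin c d t hc hd hcd ht hdt e2 (Or.inr e1)
  refine ⟨a, b, hpo, hp1, hp2, hpG, ⟨s, hs, hps⟩, hright, ?_, ?_⟩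
  · rintro c d t hc hd hcd ht (H | H)
    · exact hleft d c t hd hc hcd.symm ht H
    · exact hleft c d t hc hd hcd ht H
  · rintro c d t hc hd hcd ht (H | H)
    · exact hleft' d c t hd hc hcd.symm ht H
    · exact hleft' c d t hc hd hcd ht H

end WheelOrder

/-! ### Graph counts and two finite summation lemmas -/

/-- `G` is isomorphic to a graph of the family `𝒢`. -/
def InFamily {m : ℕ} {W : Type*} (𝒢 : Set (SimpleGraph (Fin m))) (G : SimpleGraph W) : Prop :=
  ∃ A ∈ 𝒢, Nonempty (G ≃g A)

/-- The number of admissible graphs isomorphic to a graph of the family. -/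
noncomputable def admissibleCount {m : ℕ} {W : Type*} (𝒢 : Set (SimpleGraph (Fin m))) (o : W)
    (L : W → W → W → Prop) : ℕ :=
  {G : SimpleGraph W | InFamily 𝒢 G ∧ Admissible o L G}.ncard

/-- The number of admissible graphs isomorphic to a graph of the family in which the neighbours of
`o` lie behind the edge `a b`. -/
noncomputable def behindCount {m : ℕ} {W : Type*} (𝒢 : Set (SimpleGraph (Fin m))) (o : W)
    (L : W → W → W → Prop) (a b : W) : ℕ :=
  {G : SimpleGraph W | (InFamily 𝒢 G ∧ Admissible o L G) ∧ Behind o L G a b}.ncard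

/-- The number of points other than `o` to the right of the line from `a` to `b`. -/
noncomputable def rightOf {W : Type*} (o : W) (L : W → W → W → Prop) (a b : W) : ℕ :=
  {c | c ≠ o ∧ L b a c}.ncard

theorem ncard_eq_add_sum_of_existsUnique {α β : Type*} [Finite α] [Fintype β] {B V : α → Prop}
    {Q : α → β → Prop} {R : β → Prop} [DecidablePred R]
    (h0 : ∀ x, V x → B x)
    (h1 : ∀ x, V x → ∀ p, R p → ¬ Q x p)
    (h2 : ∀ x, B x → ¬ V x → ∃ p, R p ∧ Q x p)
    (h3 : ∀ x p q, B x → R p → R q → Q x p → Q x q → p = q) :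
    {x | B x}.ncard = {x | V x}.ncard + ∑ p with R p, {x | B x ∧ Q x p}.ncard := by
  classical
  have := Fintype.ofFinite α
  have e : {x | B x} = {x | V x} ∪ ⋃ p ∈ Finset.univ.filter R, {x | B x ∧ Q x p} := by
    ext x
    simp only [Set.mem_ofPred_eq, Set.mem_union, Set.mem_iUnion, Finset.mem_filter,
      Finset.mem_univ, true_and, exists_prop]
    constructor
    · intro hx
      by_cases hv : V x
      · exact Or.inl hv
      · obtain ⟨p, hp, hq⟩ := h2 x hx hv
        exact Or.inr ⟨p, hp, hx, hq⟩
    · rintro (hx | ⟨p, hp, hx, -⟩)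
      · exact h0 x hx
      · exact hx
  rw [e, Set.ncard_union_eq]
  · congr 1
    rw [show (⋃ p ∈ Finset.univ.filter R, {x | B x ∧ Q x p}) =
      (((Finset.univ.filter R).biUnion fun p => ({x | B x ∧ Q x p} : Set α).toFinset : Finset α) :
        Set α) by ext; simp, Set.ncard_coe_finset, Finset.card_biUnion]
    · exact Finset.sum_congr rfl fun p _ => (Set.ncard_eq_toFinset_card' _).symm
    · intro p hp q hq hpq
      refine Finset.disjoint_left.2 fun x hx hx' => hpq ?_
      simp only [Set.mem_toFinset, Set.mem_ofPred_eq] at hx hx'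
      exact h3 x p q hx.1 (by simpa using hp) (by simpa using hq) hx.2 hx'.2
  · refine Set.disjoint_left.2 fun x hx hx' => ?_
    simp only [Set.mem_iUnion, Finset.mem_filter, Finset.mem_univ, true_and, exists_prop,
      Set.mem_ofPred_eq] at hx'
    obtain ⟨p, hp, -, hq⟩ := hx'
    exact h1 x hx p hp hq

/-- Summing over the ranks of the elements of a finite set with respect to a strict total order. -/
theorem sum_rank {β M : Type*} [AddCommMonoid M] (T : Finset β) (r : β → β → Prop)
    [DecidableRel r] (irrefl : ∀ a ∈ T, ¬ r a a)
    (trans : ∀ a ∈ T, ∀ b ∈ T, ∀ c ∈ T, r a b → r b c → r a c)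
    (total : ∀ a ∈ T, ∀ b ∈ T, a ≠ b → r a b ∨ r b a) (f : ℕ → M) :
    ∑ b ∈ T, f (T.filter (r · b)).card = ∑ k ∈ Finset.range T.card, f k := by
  have hlt : ∀ a ∈ T, ∀ b ∈ T, r a b → (T.filter (r · a)).card < (T.filter (r · b)).card := by
    intro a ha b hb hab
    refine Finset.card_lt_card ⟨fun x hx => ?_, fun hss => ?_⟩
    · simp only [Finset.mem_filter] at hx ⊢
      exact ⟨hx.1, trans x hx.1 a ha b hb hx.2 hab⟩
    · exact irrefl a ha (Finset.mem_filter.1 (hss (Finset.mem_filter.2 ⟨ha, hab⟩))).2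
  have hinj : Set.InjOn (fun b => (T.filter (r · b)).card) T := by
    intro a ha b hb hab
    by_contra hne
    rcases total a ha b hb hne with H | H
    · exact (hlt a ha b hb H).ne hab
    · exact (hlt b hb a ha H).ne hab.symm
  rw [← Finset.sum_image (g := fun b => (T.filter (r · b)).card) hinj]
  congr 1
  refine Finset.eq_of_subset_of_card_le (fun k hk => ?_) ?_
  · obtain ⟨b, hb, rfl⟩ := Finset.mem_image.1 hk
    exact Finset.mem_range.2 (Finset.card_lt_card ⟨Finset.filter_subset _ _, fun hss =>
      irrefl b hb (Finset.mem_filter.1 (hss hb)).2⟩)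
  · rw [Finset.card_range, Finset.card_image_of_injOn hinj]

/-! ### Invariance of the counts under bijections preserving the rim orientation -/

section Transport

variable {W W' : Type*} {o : W} {o' : W'} {L : W → W → W → Prop} {L' : W' → W' → W' → Prop}
  {e : W ≃ W'}

/-- The bijection `e` preserves the centre and, on the other points, the orientation. -/
structure IsWheelEquiv (o : W) (L : W → W → W → Prop) (o' : W') (L' : W' → W' → W' → Prop)
    (e : W ≃ W') : Prop where
  map_centre : e o = o'
  map_left : ∀ {a b c}, a ≠ o → b ≠ o → c ≠ o → (L' (e a) (e b) (e c) ↔ L a b c)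

namespace IsWheelEquiv

theorem ne_centre (he : IsWheelEquiv o L o' L' e) {a : W} (ha : a ≠ o) : e a ≠ o' := by
  rw [← he.map_centre]; exact e.injective.ne ha

theorem symm (he : IsWheelEquiv o L o' L' e) : IsWheelEquiv o' L' o L e.symm where
  map_centre := by rw [← he.map_centre, e.symm_apply_apply]
  map_left := fun {a b c} ha hb hc => by
    have hne : ∀ {x}, x ≠ o' → e.symm x ≠ o := fun {x} hx hx' => hx (by
      rw [← he.map_centre, ← hx', e.apply_symm_apply])
    simpa using (he.map_left (hne ha) (hne hb) (hne hc)).symm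

theorem separates (he : IsWheelEquiv o L o' L' e) {a b p q : W} (ha : a ≠ o) (hb : b ≠ o)
    (hp : p ≠ o) (hq : q ≠ o) : Separates L' (e a) (e b) (e p) (e q) ↔ Separates L a b p q := by
  simp only [Separates, he.map_left ha hb hp, he.map_left ha hb hq, he.map_left hb ha hp,
    he.map_left hb ha hq]

theorem admissible (he : IsWheelEquiv o L o' L' e) {G : SimpleGraph W'} (hG : Admissible o' L' G) :
    Admissible o L (G.comap e) where
  noncrossing := fun a b c d ha hb hc hd hab hcd hs =>
    hG.noncrossing _ _ _ _ (he.ne_centre ha) (he.ne_centre hb) (he.ne_centre hc) (he.ne_centre hd)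
      hab hcd ((he.separates ha hb hc hd).2 hs)
  unsplit := fun a b s t ha hb hab hs ht hsep =>
    hG.unsplit _ _ _ _ (he.ne_centre ha) (he.ne_centre hb) hab (he.map_centre ▸ hs)
      (he.map_centre ▸ ht) ((he.separates ha hb (G.ne_of_adj hs |> fun h h' => h (by rw [h']))
        (G.ne_of_adj ht |> fun h h' => h (by rw [h']))).2 hsep)

theorem behind (he : IsWheelEquiv o L o' L' e) {G : SimpleGraph W'} {a b : W}
    (hG : Behind o' L' G (e a) (e b)) : Behind o L (G.comap e) a b := by
  have ha : a ≠ o := fun h => hG.left_ne (by rw [h, he.map_centre])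
  have hb : b ≠ o := fun h => hG.right_ne (by rw [h, he.map_centre])
  have hadj : ∀ {s}, (G.comap e).Adj o s → G.Adj o' (e s) ∧ s ≠ o := fun {s} hs =>
    ⟨he.map_centre ▸ hs, hs.ne.symm⟩
  refine ⟨ha, hb, hG.adj, ?_, fun s hs => ?_, fun c d s hc hd hcd hs hsep => ?_,
    fun c d s hc hd hcd hs hsep => ?_⟩
  · obtain ⟨s, hs, hsr⟩ := hG.exists_right
    obtain ⟨s, rfl⟩ := e.surjective s
    have hs' : (G.comap e).Adj o s := by rw [SimpleGraph.comap_adj, he.map_centre]; exact hs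
    exact ⟨s, hs', (he.map_left hb ha (hadj hs').2).1 hsr⟩
  · have := hG.right _ (hadj hs).1
    rwa [e.apply_eq_iff_eq, e.apply_eq_iff_eq, he.map_left hb ha (hadj hs).2] at this
  · exact hG.same_left _ _ _ (he.ne_centre hc) (he.ne_centre hd) hcd (hadj hs).1
      ((he.separates hc hd (hadj hs).2 ha).2 hsep)
  · exact hG.same_right _ _ _ (he.ne_centre hc) (he.ne_centre hd) hcd (hadj hs).1
      ((he.separates hc hd (hadj hs).2 hb).2 hsep)

variable {m : ℕ} {𝒢 : Set (SimpleGraph (Fin m))}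

theorem inFamily_comap {G : SimpleGraph W'} (e : W ≃ W') (hG : InFamily 𝒢 G) :
    InFamily 𝒢 (G.comap e) := by
  obtain ⟨A, hA, ⟨i⟩⟩ := hG
  exact ⟨A, hA, ⟨(SimpleGraph.Iso.comap e G).trans i⟩⟩

theorem comap_injective (e : W ≃ W') :
    Function.Injective (fun G : SimpleGraph W' => G.comap e) := fun G G' h => by
  ext a b
  have := congrArg (fun K : SimpleGraph W => K.Adj (e.symm a) (e.symm b)) h
  simpa using this

theorem admissibleCount_le [Finite W] (he : IsWheelEquiv o L o' L' e) :
    admissibleCount 𝒢 o' L' ≤ admissibleCount 𝒢 o L :=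
  Set.ncard_le_ncard_of_injOn (fun G => G.comap e)
    (fun _ hG => ⟨inFamily_comap e hG.1, he.admissible hG.2⟩) (comap_injective e).injOn
    (Set.toFinite _)

theorem admissibleCount_eq [Finite W] (he : IsWheelEquiv o L o' L' e) :
    admissibleCount 𝒢 o' L' = admissibleCount 𝒢 o L :=
  have := Finite.of_equiv _ e
  le_antisymm he.admissibleCount_le he.symm.admissibleCount_le

theorem behindCount_le [Finite W] (he : IsWheelEquiv o L o' L' e) (a b : W) :
    behindCount 𝒢 o' L' (e a) (e b) ≤ behindCount 𝒢 o L a b :=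
  Set.ncard_le_ncard_of_injOn (fun G => G.comap e)
    (fun _ hG => ⟨⟨inFamily_comap e hG.1.1, he.admissible hG.1.2⟩, he.behind hG.2⟩)
    (comap_injective e).injOn (Set.toFinite _)

theorem behindCount_eq [Finite W] (he : IsWheelEquiv o L o' L' e) (a b : W) :
    behindCount 𝒢 o' L' (e a) (e b) = behindCount 𝒢 o L a b :=
  have := Finite.of_equiv _ e
  le_antisymm (he.behindCount_le a b) (by simpa using he.symm.behindCount_le (𝒢 := 𝒢) (e a) (e b))

end IsWheelEquiv

end Transport

/-! ### Cyclic normal form and the counting identity -/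

/-- The cyclic order of `Fin m`. -/
def CyclicLT {m : ℕ} (i j k : Fin m) : Prop :=
  (i < j ∧ j < k) ∨ (j < k ∧ k < i) ∨ (k < i ∧ i < j)

namespace WheelOrder

variable {W : Type*} {o : W} {L : W → W → W → Prop}

theorem rightOf_lt_rightOf [Finite W] (h : WheelOrder o L) {a x y : W} (ha : a ≠ o) (hx : x ≠ o)
    (hxy : L a x y) : rightOf o L a x < rightOf o L a y := by
  refine Set.ncard_lt_ncard ⟨fun c hc => ⟨hc.1, ?_⟩, fun hss => ?_⟩ (Set.toFinite _)
  · exact h.cyc' (h.trans ha (h.cyc hc.2) hxy)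
  · exact h.ne13 (hss (a := x) ⟨hx, h.cyc' hxy⟩).2 rfl

theorem rightOf_add_two_lt [Fintype W] (h : WheelOrder o L) {n : ℕ} (hW : Fintype.card W = n + 1)
    {a x : W} (ha : a ≠ o) (hx : x ≠ o) (hxa : x ≠ a) : rightOf o L a x + 2 < n + 1 := by
  classical
  have h1 : ({c | c ≠ o ∧ L x a c} : Set W) ⊆ ((({o, a, x} : Finset W)ᶜ : Finset W) : Set W) := by
    rintro c ⟨hc, hL⟩
    simp [hc, (h.ne23 hL).symm, (h.ne13 hL).symm]
  have h2 := Set.ncard_le_ncard h1 (Set.toFinite _)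
  have h3 : ({o, a, x} : Finset W).card = 3 := Finset.card_eq_three.2
    ⟨o, a, x, ha.symm, hx.symm, hxa.symm, rfl⟩
  have h4 := Finset.card_le_univ ({o, a, x} : Finset W)
  rw [Set.ncard_coe_finset, Finset.card_compl] at h2
  unfold rightOf
  omega

/-- The points other than the centre can be numbered in cyclic order, starting from a given one. -/
theorem exists_isWheelEquiv [Fintype W] (h : WheelOrder o L) {n : ℕ}
    (hW : Fintype.card W = n + 1) {a : W} (ha : a ≠ o) :
    ∃ e : W ≃ Fin (n + 1), IsWheelEquiv o L 0 CyclicLT e ∧ (e a : ℕ) = 1 ∧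
      ∀ b, b ≠ o → b ≠ a → (e b : ℕ) = rightOf o L a b + 2 := by
  classical
  have hn : 1 < n + 1 := by
    rw [← hW]; exact Fintype.one_lt_card_iff.2 ⟨a, o, ha⟩
  let f : W → ℕ := fun x => if x = o then 0 else if x = a then 1 else rightOf o L a x + 2
  have fo : f o = 0 := by simp [f]
  have fa : f a = 1 := by simp [f, ha]
  have fx : ∀ {x}, x ≠ o → x ≠ a → f x = rightOf o L a x + 2 := fun hx hx' => by simp [f, hx, hx']
  have flt : ∀ x, f x < n + 1 := by
    intro x
    by_cases hx : x = o
    · rw [hx, fo]; omega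
    by_cases hx' : x = a
    · rw [hx', fa]; omega
    rw [fx hx hx']
    exact h.rightOf_add_two_lt hW ha hx hx'
  have fmono : ∀ {x y}, x ≠ o → y ≠ o → L a x y → f x < f y := fun {x y} hx hy H => by
    rw [fx hx (h.ne12 H).symm, fx hy (h.ne13 H).symm]
    have := h.rightOf_lt_rightOf ha hx H
    omega
  have fgt : ∀ {x}, x ≠ o → x ≠ a → 1 < f x := fun hx hx' => by rw [fx hx hx']; omega
  have ftot : ∀ {x y}, x ≠ a → y ≠ a → x ≠ y → L a x y ∨ L a y x := fun hx hy hxy =>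
    (h.total hx.symm hy.symm hxy).imp_right h.cyc
  have finj : Function.Injective f := by
    intro x y hxy
    by_contra hne
    by_cases hx : x = o
    · subst hx
      by_cases hy' : y = a
      · rw [hy', fa, fo] at hxy; omega
      · have := fgt (Ne.symm hne) hy'; omega
    by_cases hy : y = o
    · subst hy
      by_cases hx' : x = a
      · rw [hx', fa, fo] at hxy; omega
      · have := fgt hne hx'; omega
    by_cases hx' : x = a
    · subst hx'
      have := fgt hy (Ne.symm hne); omega
    by_cases hy' : y = a
    · subst hy'
      have := fgt hx hne; omega
    rcases ftot hx' hy' hne with H | H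
    · exact (fmono hx hy H).ne hxy
    · exact (fmono hy hx H).ne hxy.symm
  -- These orientations would put the rim point k inside the triangle a i j.
  have hbad : ∀ {i j k}, k ≠ o → L i j k → L a i k → L a k j → False := fun hk h1 h2 h3 =>
    h.extreme hk (h.cyc' h2) (h.cyc' h1) (h.cyc h3)
  have hfwd : ∀ {i j k}, i ≠ o → j ≠ o → k ≠ o → L i j k →
      (f i < f j ∧ f j < f k) ∨ (f j < f k ∧ f k < f i) ∨ (f k < f i ∧ f i < f j) := by
    intro i j k hi hj hk H
    by_cases hia : i = a
    · subst hia
      exact Or.inl ⟨fa ▸ fgt hj (h.ne12 H).symm, fmono hj hk H⟩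
    by_cases hja : j = a
    · subst hja
      exact Or.inr (Or.inl ⟨fa ▸ fgt hk (h.ne23 H).symm, fmono hk hi (h.cyc H)⟩)
    by_cases hka : k = a
    · subst hka
      exact Or.inr (Or.inr ⟨fa ▸ fgt hi (h.ne13 H), fmono hi hj (h.cyc' H)⟩)
    rcases ftot hia hja (h.ne12 H) with H1 | H1 <;> rcases ftot hja hka (h.ne23 H) with H2 | H2 <;>
      rcases ftot hia hka (h.ne13 H) with H3 | H3
    · exact Or.inl ⟨fmono hi hj H1, fmono hj hk H2⟩
    · exact Or.inl ⟨fmono hi hj H1, fmono hj hk H2⟩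
    · exact (hbad hk H H3 H2).elim
    · exact Or.inr (Or.inr ⟨fmono hk hi H3, fmono hi hj H1⟩)
    · exact (hbad hi (h.cyc H) H1 H3).elim
    · exact Or.inr (Or.inl ⟨fmono hj hk H2, fmono hk hi H3⟩)
    · exact (hbad hj (h.cyc' H) H2 H1).elim
    · exact (hbad hj (h.cyc' H) H2 H1).elim
  let g : W → Fin (n + 1) := fun x => ⟨f x, flt x⟩
  have gbij : Function.Bijective g := (Fintype.bijective_iff_injective_and_card g).2
    ⟨fun x y hxy => finj (congrArg Fin.val hxy), by rw [hW, Fintype.card_fin]⟩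
  refine ⟨Equiv.ofBijective g gbij, ⟨Fin.ext fo, fun {i j k} hi hj hk => ⟨fun H => ?_, fun H =>
    hfwd hi hj hk H⟩⟩, fa, fun b hb hb' => fx hb hb'⟩
  have H' : (f i < f j ∧ f j < f k) ∨ (f j < f k ∧ f k < f i) ∨ (f k < f i ∧ f i < f j) := H
  have hij : i ≠ j := by rintro rfl; omega
  have hik : i ≠ k := by rintro rfl; omega
  have hjk : j ≠ k := by rintro rfl; omega
  rcases h.total hij hik hjk with K | K
  · exact K
  · have := hfwd hj hi hk K
    omega

variable {n : ℕ} {𝒢 : Set (SimpleGraph (Fin (n + 1)))}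

theorem admissibleCount_eq [Fintype W] (h : WheelOrder o L) (hW : Fintype.card W = n + 1)
    (hn : 1 ≤ n) :
    admissibleCount 𝒢 o L = admissibleCount 𝒢 (0 : Fin (n + 1)) CyclicLT := by
  obtain ⟨a, ha⟩ := Fintype.exists_ne_of_one_lt_card (by omega : 1 < Fintype.card W) o
  obtain ⟨e, he, -⟩ := h.exists_isWheelEquiv hW ha
  exact he.admissibleCount_eq.symm

/-- Numbering from a sends a to 1 and b to `rightOf o L a b + 2`, which is at most n, so `Fin.ofNat`
does not wrap around. -/
theorem behindCount_eq [Fintype W] (h : WheelOrder o L) (hW : Fintype.card W = n + 1)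
    {a b : W} (ha : a ≠ o) (hb : b ≠ o) (hab : b ≠ a) :
    behindCount 𝒢 o L a b =
      behindCount 𝒢 (0 : Fin (n + 1)) CyclicLT 1 (Fin.ofNat (n + 1) (rightOf o L a b + 2)) := by
  obtain ⟨e, he, hea, heb⟩ := h.exists_isWheelEquiv hW ha
  have e1 : e a = 1 := Fin.ext (by
    rw [hea, Fin.val_one', Nat.mod_eq_of_lt]; have := (e a).2; omega)
  have e2 : e b = Fin.ofNat (n + 1) (rightOf o L a b + 2) := Fin.ext (by
    rw [Fin.val_ofNat, ← heb b hb hab, Nat.mod_eq_of_lt (e b).2])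
  rw [← he.behindCount_eq, e1, e2]

/-- If the centre is left of ab, every rim point c right of ab precedes b around a, so the centre is
left of ac as well. Thus `rightOf o L a b` is the rank of b in the index set. -/
theorem sum_rightOf_right [Fintype W] {M : Type*} [AddCommMonoid M] (h : WheelOrder o L)
    [∀ a b c, Decidable (L a b c)] (f : ℕ → M) {a : W} (ha : a ≠ o) :
    ∑ b with L a b o, f (rightOf o L a b) = ∑ k ∈ Finset.range {b | L a b o}.ncard, f k := by
  rw [show {b | L a b o} = ((Finset.univ.filter (L a · o) : Finset W) : Set W) by simp,
    Set.ncard_coe_finset, ← sum_rank _ (fun c b => L a c b)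
    (fun b _ H => h.ne23 H rfl) (fun x _ y _ z _ h1 h2 => h.trans ha h1 h2)]
  · refine Finset.sum_congr rfl fun b hb => ?_
    classical
    rw [rightOf, Set.ncard_eq_toFinset_card']
    congr 2
    ext c
    simp only [Finset.mem_filter, Finset.mem_univ, true_and, Set.mem_toFinset,
      Set.mem_ofPred_eq] at hb ⊢
    exact ⟨fun hc => ⟨h.trans ha (h.cyc hc.2) hb, h.cyc hc.2⟩,
      fun hc => ⟨h.ne23 hc.1, h.cyc' hc.2⟩⟩
  · intro x hx y hy hxy
    simp only [Finset.mem_filter, Finset.mem_univ, true_and] at hx hy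
    exact (h.total (h.ne12 hx) (h.ne12 hy) hxy).imp_right h.cyc

theorem sum_rightOf_left [Fintype W] {M : Type*} [AddCommMonoid M] (h : WheelOrder o L)
    [∀ a b c, Decidable (L a b c)] (f : ℕ → M) {b : W} (hb : b ≠ o) :
    ∑ a with L a b o, f (rightOf o L a b) = ∑ k ∈ Finset.range {a | L a b o}.ncard, f k := by
  rw [show {a | L a b o} = ((Finset.univ.filter (L · b o) : Finset W) : Set W) by simp,
    Set.ncard_coe_finset, ← sum_rank _ (fun c a => L b a c)
    (fun a _ H => h.ne23 H rfl) (fun x _ y _ z _ h1 h2 => h.trans hb h2 h1)]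
  · refine Finset.sum_congr rfl fun a ha => ?_
    classical
    rw [rightOf, Set.ncard_eq_toFinset_card']
    congr 2
    ext c
    simp only [Finset.mem_filter, Finset.mem_univ, true_and, Set.mem_toFinset,
      Set.mem_ofPred_eq] at ha ⊢
    exact ⟨fun hc => ⟨h.cyc' (h.trans hb (h.cyc ha) hc.2), hc.2⟩,
      fun hc => ⟨h.ne13 hc.1, hc.2⟩⟩
  · intro x hx y hy hxy
    simp only [Finset.mem_filter, Finset.mem_univ, true_and] at hx hy
    exact ((h.total (h.ne12 hx).symm (h.ne12 hy).symm hxy).imp_right h.cyc).symm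

/-- The number of graphs of the family in which no two edges cross and the centre sees all its
neighbours, in terms of the numbers of points on the two sides of each line through the centre. -/
theorem two_mul_ncard_visible [Fintype W] (h : WheelOrder o L) (hW : Fintype.card W = n + 1)
    (hn : 1 ≤ n) (m : ℕ → ℕ)
    (hm : m = fun k =>
      behindCount 𝒢 (0 : Fin (n + 1)) CyclicLT 1 (Fin.ofNat (n + 1) (k + 2))) :
    2 * {G : SimpleGraph W | InFamily 𝒢 G ∧ Admissible o L G ∧ Visible o L G}.ncard +
      ∑ a, (∑ k ∈ Finset.range {b | L a b o}.ncard, m k +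
        ∑ k ∈ Finset.range {b | L b a o}.ncard, m k) =
      2 * admissibleCount 𝒢 (0 : Fin (n + 1)) CyclicLT := by
  classical
  have key := ncard_eq_add_sum_of_existsUnique
    (B := fun G : SimpleGraph W => InFamily 𝒢 G ∧ Admissible o L G)
    (V := fun G => InFamily 𝒢 G ∧ Admissible o L G ∧ Visible o L G)
    (Q := fun G p => Behind o L G p.1 p.2) (R := fun p : W × W => L p.1 p.2 o)
    (fun G hG => ⟨hG.1, hG.2.1⟩) (fun G hG p hp => not_behind_of_visible hG.2.2 hp)
    (fun G hG hv => by
      obtain ⟨a, b, hab, hB⟩ := h.exists_behind hG.2 (fun hv' => hv ⟨hG.1, hG.2, hv'⟩)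
      exact ⟨(a, b), hab, hB⟩)
    (fun G p q _ hp hq h1 h2 => Prod.ext_iff.2 (h.behind_unique hp hq h1 h2))
  have e0 : ∀ p : W × W, L p.1 p.2 o →
      {G : SimpleGraph W | (InFamily 𝒢 G ∧ Admissible o L G) ∧ Behind o L G p.1 p.2}.ncard =
        m (rightOf o L p.1 p.2) := fun p hp => by
    rw [hm]
    exact h.behindCount_eq hW (h.ne13 hp) (h.ne23 hp) (h.ne12 hp).symm
  have e1 := Finset.sum_congr (rfl : (Finset.univ.filter fun p : W × W => L p.1 p.2 o) = _)
    fun p hp => e0 p (Finset.mem_filter.1 hp).2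
  rw [e1] at key
  have e2 : ∑ p : W × W with L p.1 p.2 o, m (rightOf o L p.1 p.2) =
      ∑ a, ∑ k ∈ Finset.range {b | L a b o}.ncard, m k := by
    rw [Finset.sum_filter, Fintype.sum_prod_type]
    refine Finset.sum_congr rfl fun a _ => ?_
    rw [← Finset.sum_filter]
    by_cases ha : a = o
    · subst ha
      have hno : ∀ b, ¬ L a b a := fun b H => h.ne13 H rfl
      simp [hno]
    · exact h.sum_rightOf_right m ha
  -- The same sum grouped by the second endpoint; using both groupings makes the final weight
  -- symmetric in left and right.
  have e3 : ∑ p : W × W with L p.1 p.2 o, m (rightOf o L p.1 p.2) =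
      ∑ b, ∑ k ∈ Finset.range {a | L a b o}.ncard, m k := by
    rw [Finset.sum_filter, Fintype.sum_prod_type_right]
    refine Finset.sum_congr rfl fun b _ => ?_
    rw [← Finset.sum_filter]
    by_cases hb : b = o
    · subst hb
      have hno : ∀ a, ¬ L a b b := fun a H => h.ne23 H rfl
      simp [hno]
    · exact h.sum_rightOf_left m hb
  have e4 := h.admissibleCount_eq (𝒢 := 𝒢) hW hn
  rw [admissibleCount] at e4
  rw [Finset.sum_add_distrib, ← e2, ← e3, ← e4]
  omega

end WheelOrder

/-! ### Orientation and segments in the plane -/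

theorem orient_cyc (a b c : Plane) : orient b c a = orient a b c := by unfold orient; ring

theorem orient_swap (a b c : Plane) : orient b a c = -orient a b c := by unfold orient; ring

theorem orient_self_left (a b : Plane) : orient a b a = 0 := by unfold orient; ring

theorem orient_self_right (a b : Plane) : orient a b b = 0 := by unfold orient; ring

theorem orient_combo (a b p q : Plane) {s t : ℝ} (h : s + t = 1) :
    orient a b (s • p + t • q) = s * orient a b p + t * orient a b q := by
  obtain rfl : s = 1 - t := by linarith
  simp only [orient, PiLp.add_apply, PiLp.smul_apply, smul_eq_mul]
  ring

theorem collinear_of_orient_eq_zero {a b c : Plane} (hab : a ≠ b) (h : orient a b c = 0) :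
    Collinear ℝ ({a, b, c} : Set Plane) := by
  unfold orient at h
  have key : ∃ t : ℝ, c = t • (b - a) + a := by
    by_cases h0 : b 0 - a 0 = 0
    · have h1 : b 1 - a 1 ≠ 0 := fun h1 => hab (by
        ext i; fin_cases i
        · simp only [Fin.zero_eta]; linarith
        · simp only [Fin.mk_one]; linarith)
      refine ⟨(c 1 - a 1) / (b 1 - a 1), ?_⟩
      have h2 : c 0 - a 0 = 0 := by
        rw [h0, zero_mul, zero_sub, neg_eq_zero] at h
        exact (mul_eq_zero.1 h).resolve_left h1
      ext i; fin_cases i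
      · simp [h0]; linarith
      · simp [h1]
    · refine ⟨(c 0 - a 0) / (b 0 - a 0), ?_⟩
      ext i; fin_cases i
      · simp [h0]
      · simp; field_simp; linarith
  obtain ⟨t, ht⟩ := key
  rw [collinear_iff_of_mem (p₀ := a) (by simp)]
  refine ⟨b - a, ?_⟩
  rintro p (rfl | rfl | rfl)
  · exact ⟨0, by simp⟩
  · exact ⟨1, by simp⟩
  · exact ⟨t, by simpa using ht⟩

/-- A point inside a triangle is not an extreme point of a set containing the triangle. -/
theorem not_mem_extremePoints_of_orient {A : Set Plane} (hA : Convex ℝ A) {a x y z : Plane}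
    (hx : x ∈ A) (hy : y ∈ A) (hz : z ∈ A) (h1 : 0 < orient a x y) (h2 : 0 < orient a y z)
    (h3 : 0 < orient a z x) : a ∉ A.extremePoints ℝ := by
  intro ha
  have hconv := (hA.mem_extremePoints_iff_convex_sdiff.1 ha).2
  have hax : x ≠ a := by rintro rfl; simp [orient] at h1
  have hay : y ≠ a := by rintro rfl; simp [orient] at h2
  have haz : z ≠ a := by rintro rfl; simp [orient] at h3
  set α := orient a y z
  set β := orient a z x
  set γ := orient a x y
  have hs : 0 < α + β + γ := by positivity
  have hmem : (α / (α + β + γ)) • x + ((β + γ) / (α + β + γ)) •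
      ((β / (β + γ)) • y + (γ / (β + γ)) • z) ∈ A \ {a} := by
    refine hconv ⟨hx, hax⟩ (hconv ⟨hy, hay⟩ ⟨hz, haz⟩ (by positivity) (by positivity) ?_)
      (by positivity) (by positivity) ?_
    · field_simp
    · field_simp; ring
  refine hmem.2 ?_
  rw [Set.mem_singleton_iff]
  have hbg : β + γ ≠ 0 := by positivity
  ext i
  simp only [PiLp.add_apply, PiLp.smul_apply, smul_eq_mul]
  field_simp
  fin_cases i <;> simp only [α, β, γ, orient, Fin.zero_eta, Fin.mk_one] <;> ring

theorem exists_mem_openSegment_of_orient {a b p q : Plane} (h1 : 0 < orient a b p)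
    (h2 : orient a b q < 0) (h3 : 0 < orient p q b) (h4 : orient p q a < 0) :
    ¬ Disjoint (openSegment ℝ a b) (openSegment ℝ p q) := by
  rw [Set.not_disjoint_iff]
  set u := orient a b p
  set v := orient a b q
  set r := orient p q b
  set t := orient p q a
  have huv : 0 < u - v := by linarith
  have hrt : 0 < r - t := by linarith
  refine ⟨(r / (r - t)) • a + (-t / (r - t)) • b, ⟨_, _, by positivity,
    div_pos (by linarith) hrt, by field_simp; ring, rfl⟩, -v / (u - v), u / (u - v),
    div_pos (by linarith) huv, by positivity, by field_simp; ring, ?_⟩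
  have e : r - t = u - v := by simp only [u, v, r, t, orient]; ring
  rw [e]
  ext i
  simp only [PiLp.add_apply, PiLp.smul_apply, smul_eq_mul]
  field_simp
  fin_cases i <;> simp only [u, v, r, t, orient, Fin.zero_eta, Fin.mk_one] <;> ring

/-- The affine function `orient a b` vanishes at a common point, where it is also a positive
combination of its values at p and q. If one value is nonzero, they have opposite signs. -/
theorem orient_mul_neg_of_not_disjoint {a b p q : Plane}
    (h : ¬ Disjoint (openSegment ℝ a b) (openSegment ℝ p q))
    (hne : orient a b p ≠ 0 ∨ orient a b q ≠ 0) :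
    (0 < orient a b p ∧ orient a b q < 0) ∨ (orient a b p < 0 ∧ 0 < orient a b q) := by
  obtain ⟨x, ⟨s, t, -, -, hst, rfl⟩, ⟨u, v, hu, hv, huv, hx⟩⟩ := Set.not_disjoint_iff.1 h
  have h1 := orient_combo a b a b hst
  rw [orient_self_left, orient_self_right, ← hx, orient_combo a b p q huv] at h1
  rcases lt_trichotomy (orient a b p) 0 with hp | hp | hp
  · exact Or.inr ⟨hp, by nlinarith⟩
  · rw [hp, mul_zero, zero_add, mul_zero, mul_zero, add_zero] at h1
    exact absurd ((mul_eq_zero.1 h1).resolve_left hv.ne') (hne.resolve_left (not_not.2 hp))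
  · exact Or.inl ⟨hp, by nlinarith⟩

/-! ### Conowheel sets as wheel orders -/

/-- `c` lies to the left of the line from `a` to `b`. -/
def leftOf {P : Set Plane} (a b c : P) : Prop := 0 < orient (a : Plane) b c

namespace IsConowheelSet

variable {H : Finset Plane} {w : Plane}

/-- The extra point of a conowheel set. -/
def centre (H : Finset Plane) (w : Plane) : pointSet H w := ⟨w, Set.mem_insert _ _⟩

theorem mem_of_ne_centre {a : pointSet H w} (ha : a ≠ centre H w) : (a : Plane) ∈ H :=
  a.2.resolve_left fun h => ha (Subtype.ext h)

theorem orient_ne_zero (h : IsConowheelSet H w) {a b c : pointSet H w} (hab : a ≠ b) (hac : a ≠ c)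
    (hbc : b ≠ c) : orient (a : Plane) b c ≠ 0 := fun h0 =>
  have hab' : (a : Plane) ≠ b := fun e => hab (Subtype.ext e)
  h.generalPosition a a.2 b b.2 c c.2 hab' (fun e => hac (Subtype.ext e))
    (fun e => hbc (Subtype.ext e)) (collinear_of_orient_eq_zero hab' h0)

theorem wheelOrder (h : IsConowheelSet H w) : WheelOrder (centre H w) leftOf where
  cyc := fun {a b c} H => by rwa [leftOf, orient_cyc]
  asymm := fun {a b c} H H' => by
    rw [leftOf, orient_swap] at H'
    unfold leftOf at H
    linarith
  total := fun {a b c} hab hac hbc => by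
    rw [leftOf, leftOf, orient_swap (a : Plane), neg_pos]
    exact (h.orient_ne_zero hab hac hbc).lt_or_gt.symm
  extreme := fun {a x y z} ha h1 h2 h3 =>
    not_mem_extremePoints_of_orient (convex_convexHull ℝ _) (subset_convexHull ℝ _ x.2)
      (subset_convexHull ℝ _ y.2) (subset_convexHull ℝ _ z.2) h1 h2 h3
      (h.extreme a (mem_of_ne_centre ha))

theorem separates_iff {P : Set Plane} {a b p q : P} : Separates leftOf a b p q ↔
    (0 < orient (a : Plane) b p ∧ orient (a : Plane) b q < 0) ∨
      (orient (a : Plane) b p < 0 ∧ 0 < orient (a : Plane) b q) := by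
  simp only [Separates, leftOf, orient_swap (a : Plane) (b : Plane), neg_pos]

/-- Transitivity around the extreme points a and b puts them on opposite sides of pq as well. With a
non-extreme end, pq could meet the line ab outside the segment. -/
theorem not_disjoint_of_separates (h : IsConowheelSet H w) {a b p q : pointSet H w}
    (ha : a ≠ centre H w) (hb : b ≠ centre H w) (hs : Separates leftOf a b p q) :
    ¬ Disjoint (openSegment ℝ (a : Plane) b) (openSegment ℝ (p : Plane) q) := by
  wlog hpq : leftOf a b p ∧ leftOf b a q generalizing p q with hw
  · rw [openSegment_symm ℝ (p : Plane)]
    have := hs.resolve_left hpq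
    exact hw (Or.inl ⟨this.2, this.1⟩) ⟨this.2, this.1⟩
  have hW := h.wheelOrder
  obtain ⟨h1, h2⟩ := hpq
  have h3 : leftOf b p q := hW.trans hb (hW.cyc h1) h2
  have h4 : leftOf a q p := hW.trans ha (hW.cyc h2) h1
  refine exists_mem_openSegment_of_orient h1 ?_ (hW.cyc h3) ?_
  · have : leftOf b a q := h2
    rwa [leftOf, orient_swap, neg_pos] at this
  · have : leftOf q p a := hW.cyc h4
    rwa [leftOf, orient_swap, neg_pos] at this

theorem separates_of_not_disjoint (h : IsConowheelSet H w) {a b p q : pointSet H w}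
    (hab : a ≠ b) (hpq : p ≠ q) (hne : s(a, b) ≠ s(p, q))
    (hd : ¬ Disjoint (openSegment ℝ (a : Plane) b) (openSegment ℝ (p : Plane) q)) :
    Separates leftOf a b p q := by
  rw [separates_iff]
  refine orient_mul_neg_of_not_disjoint hd ?_
  -- Distinct edges share at most one endpoint, so p or q is off the line ab.
  have : (p ≠ a ∧ p ≠ b) ∨ (q ≠ a ∧ q ≠ b) := by
    by_contra! hc
    refine hne (Sym2.eq_iff.2 ?_)
    by_cases hpa : p = a
    · exact Or.inl ⟨hpa.symm, (hc.2 fun hqa => hpq (hpa.trans hqa.symm)).symm⟩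
    · have hpb := hc.1 hpa
      refine Or.inr ⟨?_, hpb.symm⟩
      by_contra hqa
      exact hpq (hpb.trans (hc.2 (Ne.symm hqa)).symm)
  exact this.imp (fun hp => h.orient_ne_zero hab hp.1.symm hp.2.symm)
    (fun hq => h.orient_ne_zero hab hq.1.symm hq.2.symm)

theorem isCrossingFree_iff (h : IsConowheelSet H w) {G : SimpleGraph (pointSet H w)} :
    IsCrossingFree G ↔ Admissible (centre H w) leftOf G ∧ Visible (centre H w) leftOf G := by
  have hW := h.wheelOrder
  constructor
  · intro hG
    have key : ∀ a b p q, a ≠ centre H w → b ≠ centre H w → G.Adj a b → G.Adj p q →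
        ¬ Separates leftOf a b p q := by
      intro a b p q ha hb hab hpq hs
      refine h.not_disjoint_of_separates ha hb hs (hG a b p q hab hpq fun e => ?_)
      rcases Sym2.eq_iff.1 e with ⟨rfl, rfl⟩ | ⟨rfl, rfl⟩ <;>
        exact hs.elim (fun H => by first | exact hW.ne13 H.1 rfl | exact hW.ne23 H.1 rfl)
          (fun H => by first | exact hW.ne13 H.1 rfl | exact hW.ne23 H.1 rfl)
    refine ⟨⟨fun a b c d ha hb _ _ hab hcd => key a b c d ha hb hab hcd,
      fun a b s t ha hb hab hs ht hst => ?_⟩, fun a b s ha hb hab hs => key a b _ s ha hb hab hs⟩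
    -- An edge separating s from t has the centre on one side, so it separates the centre from s or
    -- from t.
    have hs' := key a b _ s ha hb hab hs
    have ht' := key a b _ t ha hb hab ht
    rcases hW.total hab.ne ha hb with H | H <;> rcases hst with K | K
    · exact ht' (Or.inl ⟨H, K.2⟩)
    · exact hs' (Or.inl ⟨H, K.1⟩)
    · exact hs' (Or.inr ⟨H, K.1⟩)
    · exact ht' (Or.inr ⟨H, K.2⟩)
  · rintro ⟨hA, hV⟩
    have key : ∀ a b p q, a ≠ centre H w → b ≠ centre H w → G.Adj a b → G.Adj p q →
        ¬ Separates leftOf a b p q := by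
      intro a b p q ha hb hab hpq hs
      by_cases hp : p = centre H w
      · exact hV a b q ha hb hab (hp ▸ hpq) (hp ▸ hs)
      by_cases hq : q = centre H w
      · exact hV a b p ha hb hab (hq ▸ hpq.symm) (hq ▸ (Or.symm (hs.imp And.symm And.symm)))
      exact hA.noncrossing a b p q ha hb hp hq hab hpq hs
    intro a b p q hab hpq hne
    by_contra hd
    have s1 := h.separates_of_not_disjoint hab.ne hpq.ne hne hd
    have s2 := h.separates_of_not_disjoint hpq.ne hab.ne hne.symm (fun hd' => hd hd'.symm)
    by_cases ho : a ≠ centre H w ∧ b ≠ centre H w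
    · exact key a b p q ho.1 ho.2 hab hpq s1
    by_cases ho' : p ≠ centre H w ∧ q ≠ centre H w
    · exact key p q a b ho'.1 ho'.2 hpq hab s2
    -- Both edges now contain the centre; a shared endpoint lies on the line ab and cannot be
    -- strictly on one side of it.
    have hcommon : (a = p ∨ a = q) ∨ (b = p ∨ b = q) := by
      by_contra! hc
      have h1 : a = centre H w ∨ b = centre H w := by tauto
      have h2 : p = centre H w ∨ q = centre H w := by tauto
      rcases h1 with h1 | h1 <;> rcases h2 with h2 | h2 <;> simp_all
    rcases s1 with ⟨K1, K2⟩ | ⟨K1, K2⟩ <;> rcases hcommon with (rfl | rfl) | (rfl | rfl) <;>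
      first | exact hW.ne13 K1 rfl | exact hW.ne23 K1 rfl | exact hW.ne13 K2 rfl |
        exact hW.ne23 K2 rfl

theorem leftCount_eq (a : pointSet H w) :
    leftCount H w a = {b : pointSet H w | leftOf a b (centre H w)}.ncard := by
  rw [leftCount, ← Set.ncard_image_of_injective _ Subtype.val_injective]
  congr 1
  ext p
  simp [leftOf, centre, orient_cyc w, and_comm]

theorem rightCount_eq (a : pointSet H w) :
    rightCount H w a = {b : pointSet H w | leftOf b a (centre H w)}.ncard := by
  rw [rightCount, ← Set.ncard_image_of_injective _ Subtype.val_injective]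
  congr 1
  ext p
  have e : ∀ p, orient p a w = - orient w a p := fun p => by unfold orient; ring
  simp [leftOf, centre, e, and_comm]

end IsConowheelSet

theorem WheelOrder.ncard_left_add_ncard_right {W : Type*} [Fintype W] {o : W}
    {L : W → W → W → Prop} (h : WheelOrder o L) {n : ℕ} (hW : Fintype.card W = n + 1) {a : W}
    (ha : a ≠ o) : {b | L a b o}.ncard + {b | L b a o}.ncard + 1 = n := by
  classical
  have hd : Disjoint {b | L a b o} {b | L b a o} :=
    Set.disjoint_left.2 fun b h1 h2 => h.asymm h1 h2
  have hu : {b | L a b o} ∪ {b | L b a o} = ((({a, o} : Finset W)ᶜ : Finset W) : Set W) := by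
    ext b
    simp only [Set.mem_union, Set.mem_ofPred_eq, Finset.coe_compl, Finset.coe_insert,
      Finset.coe_singleton, Set.mem_compl_iff, Set.mem_insert_iff, Set.mem_singleton_iff, not_or]
    refine ⟨?_, fun hb => h.total (Ne.symm hb.1) ha hb.2⟩
    rintro (H | H)
    · exact ⟨(h.ne12 H).symm, h.ne23 H⟩
    · exact ⟨h.ne12 H, h.ne13 H⟩
  have h2 : ({a, o} : Finset W).card = 2 := Finset.card_pair ha
  have h3 := Finset.card_le_univ ({a, o} : Finset W)
  rw [← Set.ncard_union_eq hd, hu, Set.ncard_coe_finset, Finset.card_compl]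
  omega

/-! ### The counting identity in terms of left and right counts and the frequency vector -/

namespace IsConowheelSet

variable {H : Finset Plane} {w : Plane} {n : ℕ}

noncomputable instance : Fintype (pointSet H w) :=
  Set.Finite.fintype (H.finite_toSet.insert w)

theorem card_pointSet (h : IsConowheelSet H w) (hH : H.card = n) :
    Fintype.card (pointSet H w) = n + 1 := by
  rw [← Nat.card_eq_fintype_card, Nat.card_coe_set_eq, pointSet,
    Set.ncard_insert_of_notMem (by simpa using h.notMem), Set.ncard_coe_finset, hH]

theorem leftCount_add_rightCount (h : IsConowheelSet H w) (hH : H.card = n) {p : Plane}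
    (hp : p ∈ H) : leftCount H w p + rightCount H w p + 1 = n := by
  have ha : (⟨p, Set.mem_insert_of_mem _ hp⟩ : pointSet H w) ≠ centre H w := fun e =>
    h.notMem (by have := congrArg Subtype.val e; simp only [centre] at this; rwa [← this])
  have := h.wheelOrder.ncard_left_add_ncard_right (h.card_pointSet hH) ha
  rwa [← leftCount_eq, ← rightCount_eq] at this

theorem two_mul_numCrossingFree (h : IsConowheelSet H w) (hH : H.card = n) (hn : 1 ≤ n)
    (𝒢 : Set (SimpleGraph (Fin (n + 1)))) (m : ℕ → ℕ)
    (hm : m = fun k =>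
      behindCount 𝒢 (0 : Fin (n + 1)) CyclicLT 1 (Fin.ofNat (n + 1) (k + 2))) :
    2 * numCrossingFree 𝒢 (pointSet H w) + ∑ p ∈ H, (∑ k ∈ Finset.range (leftCount H w p), m k +
        ∑ k ∈ Finset.range (rightCount H w p), m k) =
      2 * admissibleCount 𝒢 (0 : Fin (n + 1)) CyclicLT := by
  classical
  have key := h.wheelOrder.two_mul_ncard_visible (𝒢 := 𝒢) (h.card_pointSet hH) hn m hm
  rw [← key]
  refine congrArg₂ (· + ·) (congrArg (2 * ·) ?_) ?_
  · rw [numCrossingFree]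
    congr 1
    ext G
    simp only [Set.mem_ofPred_eq, h.isCrossingFree_iff, InFamily]
    tauto
  · have e1 : ∀ a : pointSet H w,
        (∑ k ∈ Finset.range {b | leftOf a b (centre H w)}.ncard, m k +
          ∑ k ∈ Finset.range {b | leftOf b a (centre H w)}.ncard, m k) =
        (fun p => ∑ k ∈ Finset.range (leftCount H w p), m k +
          ∑ k ∈ Finset.range (rightCount H w p), m k) (a : Plane) := fun a => by
      simp only [leftCount_eq, rightCount_eq]
    -- The identity sums over all points; the centre contributes nothing, its degenerate counts
    -- being zero.
    have hw0 : leftCount H w w = 0 ∧ rightCount H w w = 0 := by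
      constructor <;> simp [leftCount, rightCount, orient]
    refine Eq.trans ?_ (Finset.sum_congr rfl fun a _ => (e1 a).symm)
    have e2 := Finset.sum_subtype (F := inferInstanceAs (Fintype (pointSet H w))) (insert w H)
      (p := (· ∈ pointSet H w)) (fun x => by simp [pointSet])
      (fun p => ∑ k ∈ Finset.range (leftCount H w p), m k +
          ∑ k ∈ Finset.range (rightCount H w p), m k)
    rw [Finset.sum_insert h.notMem, hw0.1, hw0.2] at e2
    simpa using e2

/-- The difference of the two counts of a rim point, which is less than the number of rim points. -/
theorem natAbs_lt (h : IsConowheelSet H w) (hH : H.card = n) {p : Plane} (hp : p ∈ H) :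
    ((leftCount H w p : ℤ) - rightCount H w p).natAbs < n := by
  have := h.leftCount_add_rightCount hH hp
  omega

theorem sum_eq_sum_freqVector (h : IsConowheelSet H w) (hH : H.card = n) (f : ℕ → ℚ) :
    ∑ p ∈ H, f ((leftCount H w p : ℤ) - rightCount H w p).natAbs =
      ∑ k : Fin n, (freqVector n H w k : ℚ) * f k := by
  classical
  have e : ∀ k : Fin n, freqVector n H w k =
      (H.filter fun p => ((leftCount H w p : ℤ) - rightCount H w p).natAbs = k).card := fun k => by
    rw [freqVector, ← Set.ncard_coe_finset]
    congr 1
    ext p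
    simp only [Set.mem_ofPred_eq, Finset.coe_filter, Finset.mem_coe, Int.abs_eq_natAbs,
      Nat.cast_inj]
  rw [← Finset.sum_fiberwise_of_maps_to (t := Finset.range n)
    (g := fun p => ((leftCount H w p : ℤ) - rightCount H w p).natAbs)
    (fun p hp => Finset.mem_range.2 (h.natAbs_lt hH hp)), ← Fin.sum_univ_eq_sum_range
    (fun k => ∑ p ∈ H with ((leftCount H w p : ℤ) - rightCount H w p).natAbs = k,
      f ((leftCount H w p : ℤ) - rightCount H w p).natAbs)]
  refine Finset.sum_congr rfl fun k _ => ?_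
  rw [e, Finset.sum_congr rfl fun p hp => by rw [(Finset.mem_filter.1 hp).2], Finset.sum_const,
    nsmul_eq_mul]

end IsConowheelSet

theorem theorem3 (n : ℕ) (hn : 1 ≤ n) (𝒢 : Set (SimpleGraph (Fin (n + 1)))) :
    (∀ (H H' : Finset Plane) (w w' : Plane),
      H.card = n → IsConowheelSet H w → H'.card = n → IsConowheelSet H' w' →
      freqVector n H w = freqVector n H' w' →
      numCrossingFree 𝒢 (pointSet H w) = numCrossingFree 𝒢 (pointSet H' w')) ∧
    ∃ (γ : ℤ) (lam : ℕ → ℕ → ℤ) (Lam : Fin n → ℚ),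
      (∀ l r : ℕ, lam l r = lam r l) ∧
      ∀ (H : Finset Plane) (w : Plane), H.card = n → IsConowheelSet H w →
        (numCrossingFree 𝒢 (pointSet H w) : ℚ) =
            (γ : ℚ) - (1 / 2 : ℚ) * ∑ h ∈ H, (lam (leftCount H w h) (rightCount H w h) : ℚ) ∧
        (numCrossingFree 𝒢 (pointSet H w) : ℚ) =
            ∑ k : Fin n, (freqVector n H w k : ℚ) * Lam k := by
  obtain ⟨m, hm⟩ : ∃ m : ℕ → ℕ, m = fun k =>
    behindCount 𝒢 (0 : Fin (n + 1)) CyclicLT 1 (Fin.ofNat (n + 1) (k + 2)) := ⟨_, rfl⟩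
  set γ : ℕ := admissibleCount 𝒢 (0 : Fin (n + 1)) CyclicLT with hγ
  let lam : ℕ → ℕ → ℤ := fun l r =>
    ∑ k ∈ Finset.range l, (m k : ℤ) + ∑ k ∈ Finset.range r, (m k : ℤ)
  have lam_comm : ∀ l r, lam l r = lam r l := fun l r => add_comm _ _
  -- γ is spread evenly over the n rim points, and l, r are recovered from l + r = n - 1 and |l - r|
  -- = k. For k of the wrong parity the rounded value is irrelevant, since no rim point attains k.
  let f : ℕ → ℚ := fun k => (γ : ℚ) / n - (1 / 2 : ℚ) * lam ((n - 1 + k) / 2) ((n - 1 - k) / 2)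
  have h1 : ∀ (H : Finset Plane) (w : Plane), H.card = n → IsConowheelSet H w →
      (numCrossingFree 𝒢 (pointSet H w) : ℚ) =
        ((γ : ℤ) : ℚ) - (1 / 2 : ℚ) * ∑ h ∈ H, (lam (leftCount H w h) (rightCount H w h) : ℚ) := by
    intro H w hH h
    have key := congrArg (Nat.cast : ℕ → ℚ) (h.two_mul_numCrossingFree hH hn 𝒢 m hm)
    push_cast at key
    simp only [lam, Int.cast_add, Int.cast_sum, Int.cast_natCast]
    linarith
  have h2 : ∀ (H : Finset Plane) (w : Plane), H.card = n → IsConowheelSet H w →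
      (numCrossingFree 𝒢 (pointSet H w) : ℚ) = ∑ k : Fin n, (freqVector n H w k : ℚ) * f k := by
    intro H w hH h
    have hn0 : (n : ℚ) ≠ 0 := by positivity
    rw [h1 H w hH h, ← h.sum_eq_sum_freqVector hH f]
    have e : ∀ p ∈ H, f ((leftCount H w p : ℤ) - rightCount H w p).natAbs =
        (γ : ℚ) / n - (1 / 2 : ℚ) * lam (leftCount H w p) (rightCount H w p) := by
      intro p hp
      have hs := h.leftCount_add_rightCount hH hp
      simp only [f]
      rcases le_total (rightCount H w p) (leftCount H w p) with hle | hle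
      · congr 4 <;> omega
      · rw [lam_comm]
        congr 4 <;> omega
    rw [Finset.sum_congr rfl e, Finset.sum_sub_distrib, Finset.sum_const, hH, ← Finset.mul_sum,
      nsmul_eq_mul, mul_div_cancel₀ _ hn0, Int.cast_natCast]
  refine ⟨fun H H' w w' hH h hH' h' hF => ?_, γ, lam, fun k => f k, lam_comm,
    fun H w hH h => ⟨h1 H w hH h, h2 H w hH h⟩⟩
  have := (h2 H w hH h).trans (hF ▸ (h2 H' w' hH' h').symm)
  exact_mod_cast this
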